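/- **Setting.** Let $N,T\ge 1$ be integers, $\varepsilon>0$, $\mathcal X\subset\mathbb R^N$ a compact convex decision set, $\mathcal Y\subset\mathbb R^N$ a loss set, and $l_1,\dots,l_T\in\mathcal Y$ a sequence of loss vectors fixed in advance. For $\lambda\ge 0$ let $\mathrm{Lap}^N(\lambda)$ be the law on $\mathbb R^N$ whose coordinates are independent Laplace variables with parameter $\lambda$ (density $\frac1{2\lambda}e^{-|x|/\lambda}$; the point mass at $0$ if $\lambda=0$). *Algorithm (FTRL with tree-based aggregation).* Inputs: $\lambda$, a regularizer $R:\mathcal X\to\mathbb R$, a step size $\eta>0$. In round $t=1,\dots,T$ the algorithm plays $$x_t=\operatorname*{arg\,min}_{x\in\mathcal X}\big(\eta\langle x,\tilde L_{t-1}\rangle+R(x)\big),$$ and then observes $l_t$. The estimates $\tilde L_t$ of $l_1+\dots+l_t$ are as follows. Consider the binary tree whose nodes are the dyadic blocks $\{k2^j+1,\dots,(k+1)2^j\}$ of rounds, $j,k\ge 0$. Each node carries one noise vector. Let $\mathcal S_t$ be the minimum set of blocks that partitions $\{1,\dots,t\}$ (one block for each digit $1$ in the binary representation of $t$). Then $\tilde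 L_t$ is the sum, over the blocks in $\mathcal S_t$, of the sum of the losses in the block plus the noise vector of its node, plus $\lceil\log_2T\rceil-|\mathcal S_t|$ fresh noise vectors; in particular $\tilde L_0$ is a sum of $\lceil \log_2T\rceil$ fresh noise vectors. All noise vectors, those of the nodes and the fresh ones, are independent with law $\mathrm{Lap}^N(\lambda)$. The regret is $$\mathrm{Regret}=\mathbb E\Big[\sum_{t=1}^T\langle l_t,x_t\rangle-\min_{x\in\mathcal X}\sum_{t=1}^T\langle l_t,x\rangle\Big],$$ the expectation being over the noise. **Corollary.** There is an absolute constant $C>0$ such that in each of the following cases, for all $N,T\ge1$ there is a step size $\eta>0$ (depending only on $N$ and $T$) such that for every $\varepsilon>0$ and every sequence $l_1,\dots,l_T\in\mathcal Y$ the expectation exists and the stated bound holds. 1. **Prediction with expert advice:** $\mathcal X=\{x: x_i\ge0,\ \sum_i x_i=1\}$, $\mathcal Y=\{l:\|l\|_\infty\le1\}$, $\lambda=\frac{N\log_2T}{\varepsilon}$, $R(x)=\sum_{i=1}^N x_i\log x_i$ (with $0\log0=0$): $$\mathrm{Regret}\le C\Big(\sqrt{T\log N}+\frac{N\log^2T\,\log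 N}{\varepsilon}\Big).$$ 2. **Sphere:** $\mathcal X=\mathcal Y=\{x:\|x\|_2\le1\}$, $\lambda=\frac{\sqrt N\log_2T}{\varepsilon}$, $R(x)=\|x\|_2^2$: $$\mathrm{Regret}\le C\Big(\sqrt T+\frac{N\log^2T}{\varepsilon}\Big).$$ 3. **Cube:** $\mathcal X=\{x:\|x\|_\infty\le1\}$, $\mathcal Y=\{l:\|l\|_1\le1\}$, $\lambda=\frac{\log_2T}{\varepsilon}$, $R(x)=\|x\|_2^2$: $$\mathrm{Regret}\le C\Big(\sqrt{NT}+\frac{N\log^2T}{\varepsilon}\Big).$$ -/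

import Mathlib

open MeasureTheory
open scoped RealInnerProductSpace

namespace PrivateFTRL

/-- `ℝ^N` with its Euclidean structure. -/
abbrev Vec (N : ℕ) := EuclideanSpace ℝ (Fin N)

noncomputable section

/-! ### Laplace noise -/

/-- The density `exp (-|x|) / 2` of the standard Laplace distribution. -/
def stdLaplaceDensity (x : ℝ) : ℝ := Real.exp (-|x|) / 2

/-- The Laplace distribution on `ℝ` with parameter `lam`: the law of `lam * Y` with `Y` standard
Laplace. For `lam > 0` it has density `exp (-|x| / lam) / (2 * lam)`; for `lam = 0` it is the point
mass at `0`. -/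
def laplace (lam : ℝ) : Measure ℝ :=
  (volume.withDensity fun x => ENNReal.ofReal (stdLaplaceDensity x)).map fun x => lam * x

theorem integrable_stdLaplaceDensity : Integrable stdLaplaceDensity := by
  have h : Integrable fun x : ℝ => Real.exp (-|x|) := by
    refine Integrable.of_integral_ne_zero ?_
    rw [integral_comp_abs (f := fun x => Real.exp (-x)), integral_exp_neg_Ioi_zero]
    norm_num
  exact h.div_const 2

instance (lam : ℝ) : IsProbabilityMeasure (laplace lam) := by
  have hI := integrable_stdLaplaceDensity
  have : IsProbabilityMeasure
      (volume.withDensity fun x => ENNReal.ofReal (stdLaplaceDensity x)) := by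
    constructor
    rw [withDensity_apply _ MeasurableSet.univ, Measure.restrict_univ,
      ← ofReal_integral_eq_lintegral_ofReal hI
        (Filter.Eventually.of_forall fun x => by unfold stdLaplaceDensity; positivity)]
    have : ∫ x, stdLaplaceDensity x = 1 := by
      unfold stdLaplaceDensity
      rw [integral_div, integral_comp_abs (f := fun x => Real.exp (-x)),
        integral_exp_neg_Ioi_zero]
      norm_num
    rw [this]; simp
  exact Measure.isProbabilityMeasure_map (by fun_prop)

/-- `Lap^N(lam)`: the coordinates are independent, each with law `laplace lam`. -/
def laplaceVec (N : ℕ) (lam : ℝ) : Measure (Vec N) :=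
  (Measure.pi fun _ : Fin N => laplace lam).map (WithLp.toLp 2)

instance (N : ℕ) (lam : ℝ) : IsProbabilityMeasure (laplaceVec N lam) :=
  Measure.isProbabilityMeasure_map (by fun_prop)

/-- Names of the noise vectors that the algorithm draws: `node j k` is the noise stored at the
`k`-th node of height `j` in the binary tree, `fresh t i` is the `i`-th of the additional samples
drawn at time `t` (`t = 0` is the initialization). -/
inductive NoiseId
  | node (j k : ℕ)
  | fresh (t i : ℕ)

/-- The probability space of the algorithm: all noise vectors are independent with law
`Lap^N(lam)`. -/
def noise (N : ℕ) (lam : ℝ) : Measure (NoiseId → Vec N) :=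
  Measure.infinitePi fun _ => laplaceVec N lam

/-! ### Tree-based aggregation

Rounds are numbered `1, 2, …`. The node `(j, k)` of the binary tree (height `j`, position `k`; the
leaves have height `0`) stands for the block of rounds `k * 2 ^ j + 1, …, (k + 1) * 2 ^ j`; it is
populated once the last of these rounds is over. -/

/-- The rounds below the node `v = (height, position)`. -/
def block (v : ℕ × ℕ) : Finset ℕ := Finset.Ioc (v.2 * 2 ^ v.1) ((v.2 + 1) * 2 ^ v.1)

/-- The minimum set of nodes populated at time `t` whose blocks partition the rounds `1, …, t`.
It is read off the binary representation of `t`: each binary digit `1`, say the one of weight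
`2 ^ j`, contributes the node of height `j` whose block ends with round `(t / 2 ^ j) * 2 ^ j`. -/
def prefixNodes (t : ℕ) : Finset (ℕ × ℕ) :=
  ((Finset.range t).filter fun j => t.testBit j).image fun j => (j, t / 2 ^ j - 1)

/-- The nodes in `prefixNodes t` compute the prefix sums up to `t`. -/
theorem sum_prefixNodes {M : Type*} [AddCommMonoid M] (f : ℕ → M) (t : ℕ) :
    ∑ v ∈ prefixNodes t, ∑ s ∈ block v, f s = ∑ s ∈ Finset.Icc 1 t, f s := by
  have key : ∀ n, (∑ j ∈ (Finset.range n).filter fun j => t.testBit j,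
      ∑ s ∈ block (j, t / 2 ^ j - 1), f s) + ∑ s ∈ Finset.Ioc 0 (t / 2 ^ n * 2 ^ n), f s
        = ∑ s ∈ Finset.Ioc 0 t, f s := by
    intro n
    induction n with
    | zero => simp
    | succ n ih =>
      rw [← ih, Finset.range_add_one, Finset.filter_insert]
      have hd : t / 2 ^ (n + 1) = t / 2 ^ n / 2 := by rw [pow_succ, Nat.div_div_eq_div_mul]
      have hp : t / 2 ^ n / 2 * 2 ^ (n + 1) = (2 * (t / 2 ^ n / 2)) * 2 ^ n := by ring
      have hb : t.testBit n = decide (t / 2 ^ n % 2 = 1) := Nat.testBit_eq_decide_div_mod_eq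
      rw [hd, hp, hb]
      generalize hq : t / 2 ^ n = q
      by_cases h : q % 2 = 1
      · have h1 : 2 * (q / 2) = q - 1 := by omega
        have h2 : q - 1 + 1 = q := by omega
        simp only [h, decide_true, if_true]
        rw [Finset.sum_insert (by simp), h1, hq, add_comm (∑ s ∈ block _, f s), add_assoc]
        congr 1
        simp only [block, h2]
        rw [add_comm, ← Finset.sum_union (Finset.Ioc_disjoint_Ioc_of_le le_rfl),
          Finset.Ioc_union_Ioc_eq_Ioc (Nat.zero_le _) (Nat.mul_le_mul_right _ (Nat.sub_le _ _))]
      · have h1 : 2 * (q / 2) = q := by omega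
        simp [h, h1]
  have := key t
  rw [Nat.div_eq_of_lt Nat.lt_two_pow_self] at this
  unfold prefixNodes
  rw [Finset.sum_image (fun a _ b _ h => (Prod.ext_iff.1 h).1)]
  have hI : Finset.Icc 1 t = Finset.Ioc 0 t := by ext s; simp [Nat.succ_le_iff]
  rw [hI]
  simpa using this

/-- At most `⌈log₂ T⌉` nodes are needed at the times `t < T`. -/
theorem card_prefixNodes_le {t T : ℕ} (h : t < T) : (prefixNodes t).card ≤ Nat.clog 2 T := by
  refine Finset.card_image_le.trans ?_
  conv_rhs => rw [← Finset.card_range (Nat.clog 2 T)]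
  refine Finset.card_le_card fun j hj => ?_
  rw [Finset.mem_filter] at hj
  rw [Finset.mem_range]
  have h1 : 2 ^ j ≤ t := Nat.ge_two_pow_of_testBit hj.2
  have h2 : T ≤ 2 ^ Nat.clog 2 T := Nat.le_pow_clog one_lt_two T
  exact (Nat.pow_lt_pow_iff_right one_lt_two).1 (by omega)

/-- The estimate of `l 1 + ⋯ + l t` released by the binary tree: the sum, over the nodes in
`prefixNodes t`, of the noisy block sums stored at these nodes. -/
def privateSum {N : ℕ} (l : ℕ → Vec N) (ω : NoiseId → Vec N) (t : ℕ) : Vec N :=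
  ∑ v ∈ prefixNodes t, (∑ s ∈ block v, l s + ω (.node v.1 v.2))

/-- The estimate of `l 1 + ⋯ + l t` used by the learner, for time horizon `T`: further noise
vectors are added to `privateSum`, such that exactly `⌈log₂ T⌉ = Nat.clog 2 T` of them are contained
in the estimate. At time `0` it is the sum of `⌈log₂ T⌉` noise vectors. -/
def treeBasedAgg (T : ℕ) {N : ℕ} (l : ℕ → Vec N) (ω : NoiseId → Vec N) (t : ℕ) : Vec N :=
  privateSum l ω t +
    ∑ i ∈ Finset.range (Nat.clog 2 T - (prefixNodes t).card), ω (.fresh t i)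

/-! ### Follow the regularized leader -/

/-- A minimizer of `f` on `X` (arbitrary if there is none). -/
def argminOn {E : Type*} [Nonempty E] (X : Set E) (f : E → ℝ) : E :=
  Classical.epsilon fun x => x ∈ X ∧ IsMinOn f X x

/-- The prediction `x_t` on the decision set `X`, with regularization `R`, step size `η`, horizon `T`
and losses `l 1, l 2, …`, of which only those before round `t` matter. -/
def prediction {N : ℕ} (X : Set (Vec N)) (R : Vec N → ℝ) (η : ℝ) (T : ℕ) (l : ℕ → Vec N)
    (ω : NoiseId → Vec N) (t : ℕ) : Vec N :=
  argminOn X fun x => η * ⟪x, treeBasedAgg T l ω (t - 1)⟫ + R x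

/-- The loss of the algorithm minus that of the best fixed decision, for the noise `ω`. -/
def realizedRegret {N : ℕ} (X : Set (Vec N)) (R : Vec N → ℝ) (η : ℝ) (T : ℕ) (l : ℕ → Vec N)
    (ω : NoiseId → Vec N) : ℝ :=
  ∑ t ∈ Finset.Icc 1 T, ⟪l t, prediction X R η T l ω t⟫
    - sInf ((fun x => ∑ t ∈ Finset.Icc 1 T, ⟪l t, x⟫) '' X)

/-- "The regret, for noise parameter `lam`, is at most `B`": the realized regret has an expectation,
and that is at most `B`. -/
def RegretLE {N : ℕ} (X : Set (Vec N)) (R : Vec N → ℝ) (η lam : ℝ) (T : ℕ) (l : ℕ → Vec N)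
    (B : ℝ) : Prop :=
  Integrable (realizedRegret X R η T l) (noise N lam) ∧
    ∫ ω, realizedRegret X R η T l ω ∂(noise N lam) ≤ B

/-! ### Decision sets, loss sets and regularizers -/

/-- The probability simplex. -/
def simplex (N : ℕ) : Set (Vec N) := {x | (∀ i, 0 ≤ x i) ∧ ∑ i, x i = 1}

/-- The Euclidean unit ball. -/
def ball2 (N : ℕ) : Set (Vec N) := {x | ‖x‖ ≤ 1}

/-- The unit ball of the `ℓ_∞` norm. -/
def cube (N : ℕ) : Set (Vec N) := {x | ∀ i, |x i| ≤ 1}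

/-- The unit ball of the `ℓ_1` norm. -/
def ball1 (N : ℕ) : Set (Vec N) := {x | ∑ i, |x i| ≤ 1}

/-- Negative entropy, with `0 log 0 = 0`. -/
def entropicReg {N : ℕ} (x : Vec N) : ℝ := ∑ i, x i * Real.log (x i)

/-- The squared Euclidean norm. -/
def sqReg {N : ℕ} (x : Vec N) : ℝ := ‖x‖ ^ 2

end

end PrivateFTRL

namespace PrivateFTRL

/-! ### The noise -/

/-! For `t < T` the estimate of the prefix sum contains exactly `Nat.clog 2 T` distinct noise
vectors, so its law is that of the true prefix sum plus one sum of `Nat.clog 2 T` independent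
Laplace vectors, the same for every `t` (`map_sum_noise`, `card_noiseIds`). The losses are fixed in
advance, so the expected loss of a round depends only on the law of that round's estimate; the
correlations between rounds are irrelevant. Hence all rounds may be given the same noise `z`, namely
that of time `0`.

With `z` fixed, the algorithm is follow-the-regularized-leader with one extra initial loss `z`.
`be_the_leader` and one-round stability `S` of the leader give `regret_le_of_stable`: the regret
against `u` is at most `D / η + ⟪u - p z, z⟫ + T * S`, where `D` bounds the oscillation of `R`. The
middle term is bounded separately for each noise vector by a dual norm `W`, and costs `Nat.clog 2 T`
times the mean of `W`. Since `lam` itself contains a factor `log T`, this yields the `log² T` term.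

What remains is, for each geometry, a stability estimate (strong convexity for the squared norm, an
explicit formula for the entropy) and the mean of `W` under Laplace noise. These means all follow
from the exponential moment `expSum`, whose expectation is `2 * N`. -/

theorem map_noise_comp {N : ℕ} {lam : ℝ} {m : ℕ} {f : Fin m → NoiseId}
    (hf : Function.Injective f) :
    (noise N lam).map (fun ω i => ω (f i)) = Measure.pi fun _ : Fin m => laplaceVec N lam := by
  have h := (ProbabilityTheory.iIndepFun_infinitePi (P := fun _ : NoiseId => laplaceVec N lam)
    (X := fun _ x => x) (fun _ => measurable_id)).precomp hf
  rw [ProbabilityTheory.iIndepFun_iff_map_fun_eq_pi_map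
    fun i => (measurable_pi_apply (f i)).aemeasurable] at h
  have hm : ∀ i, Measure.map (fun ω : NoiseId → Vec N => ω (f i)) (noise N lam)
      = laplaceVec N lam := fun i => Measure.infinitePi_map_eval _ _
  simp only [noise] at hm ⊢
  simpa only [hm] using h

/-- A sum of distinct noise vectors has a law that depends only on their number. -/
theorem map_sum_noise {N : ℕ} {lam : ℝ} {I : Finset NoiseId} {m : ℕ} (hI : I.card = m) :
    (noise N lam).map (fun ω => ∑ i ∈ I, ω i)
      = (Measure.pi fun _ : Fin m => laplaceVec N lam).map fun z => ∑ i, z i := by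
  let e : Fin m ≃ I := (I.equivFinOfCardEq hI).symm
  have hinj : Function.Injective fun i => (e i : NoiseId) :=
    Subtype.val_injective.comp e.injective
  rw [← map_noise_comp hinj, Measure.map_map (by fun_prop) (by fun_prop)]
  congr 1
  ext1 ω
  rw [← Finset.sum_coe_sort]
  exact (e.sum_comp fun i : I => ω i).symm

theorem map_sum_noise_eq {N : ℕ} {lam : ℝ} {I J : Finset NoiseId} (h : I.card = J.card) :
    (noise N lam).map (fun ω => ∑ i ∈ I, ω i) = (noise N lam).map (fun ω => ∑ i ∈ J, ω i) := by
  rw [map_sum_noise h, map_sum_noise rfl]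

open Classical in
/-- The noise vectors contained in the estimate `treeBasedAgg T l ω t`. -/
noncomputable def noiseIds (T t : ℕ) : Finset NoiseId :=
  (prefixNodes t).image (fun v => NoiseId.node v.1 v.2) ∪
    (Finset.range (Nat.clog 2 T - (prefixNodes t).card)).image (NoiseId.fresh t)

theorem disjoint_noiseIds (s : Finset (ℕ × ℕ)) (r : Finset ℕ) (t : ℕ) [DecidableEq NoiseId] :
    Disjoint (s.image fun v => NoiseId.node v.1 v.2) (r.image (NoiseId.fresh t)) := by
  rw [Finset.disjoint_left]
  intro a ha hb
  obtain ⟨v, -, rfl⟩ := Finset.mem_image.1 ha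
  obtain ⟨i, -, hi⟩ := Finset.mem_image.1 hb
  cases hi

theorem injective_node : Function.Injective fun v : ℕ × ℕ => NoiseId.node v.1 v.2 := by
  rintro ⟨a, b⟩ ⟨c, d⟩ h
  cases h
  rfl

theorem injective_fresh (t : ℕ) : Function.Injective (NoiseId.fresh t) := by
  intro a b h
  cases h
  rfl

theorem card_noiseIds {T t : ℕ} (h : t < T) : (noiseIds T t).card = Nat.clog 2 T := by
  classical
  have := card_prefixNodes_le h
  rw [noiseIds, Finset.card_union_of_disjoint (disjoint_noiseIds _ _ _),
    Finset.card_image_of_injective _ injective_node,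
    Finset.card_image_of_injective _ (injective_fresh t), Finset.card_range]
  omega

theorem treeBasedAgg_eq (T : ℕ) {N : ℕ} (l : ℕ → Vec N) (ω : NoiseId → Vec N) (t : ℕ) :
    treeBasedAgg T l ω t = ∑ s ∈ Finset.Icc 1 t, l s + ∑ i ∈ noiseIds T t, ω i := by
  classical
  rw [treeBasedAgg, privateSum, Finset.sum_add_distrib, sum_prefixNodes, noiseIds,
    Finset.sum_union (disjoint_noiseIds _ _ _), Finset.sum_image (injective_node.injOn),
    Finset.sum_image ((injective_fresh t).injOn), add_assoc]

/-! ### Follow the regularized leader -/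

theorem argminOn_spec {E : Type*} [Nonempty E] {X : Set E} {f : E → ℝ}
    (h : ∃ x, x ∈ X ∧ IsMinOn f X x) : argminOn X f ∈ X ∧ IsMinOn f X (argminOn X f) :=
  Classical.epsilon_spec h

/-- The leader for the cumulative loss `L`. -/
noncomputable def leader {N : ℕ} (X : Set (Vec N)) (R : Vec N → ℝ) (η : ℝ) (L : Vec N) : Vec N :=
  argminOn X fun x => η * ⟪x, L⟫ + R x

/-- The "be the leader" inequality, with an initial loss `z`. -/
theorem be_the_leader {N : ℕ} {X : Set (Vec N)} {R : Vec N → ℝ} {η : ℝ} {p : Vec N → Vec N}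
    (hp : ∀ L, p L ∈ X ∧ IsMinOn (fun x => η * ⟪x, L⟫ + R x) X (p L))
    (l : ℕ → Vec N) (z : Vec N) (n : ℕ) {u : Vec N} (hu : u ∈ X) :
    η * ∑ t ∈ Finset.Icc 1 n, ⟪l t, p (∑ s ∈ Finset.Icc 1 t, l s + z)⟫ + η * ⟪p z, z⟫ + R (p z)
      ≤ η * ⟪u, ∑ s ∈ Finset.Icc 1 n, l s + z⟫ + R u := by
  induction n generalizing u with
  | zero => simpa using (hp z).2 hu
  | succ n ih =>
    -- It suffices to take for `u` the leader after `n + 1` rounds; the induction hypothesis is then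
    -- used with this leader as comparator.
    refine le_trans ?_ ((hp _).2 hu)
    have h := ih (hp (∑ s ∈ Finset.Icc 1 (n + 1), l s + z)).1
    have e : ∑ s ∈ Finset.Icc 1 (n + 1), l s = ∑ s ∈ Finset.Icc 1 n, l s + l (n + 1) :=
      Finset.sum_Icc_succ_top (by omega) _
    rw [Finset.sum_Icc_succ_top (by omega)]
    simp only
    set q := p (∑ s ∈ Finset.Icc 1 (n + 1), l s + z) with hq
    rw [e]
    simp only [inner_add_right] at h ⊢
    rw [real_inner_comm (l (n + 1)) q]
    linarith

/-- The regret of a stable leader against a fixed noise `z`. -/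
theorem regret_le_of_stable {N : ℕ} {X : Set (Vec N)} {R : Vec N → ℝ} {η : ℝ} (hη : 0 < η)
    {p : Vec N → Vec N} (hp : ∀ L, p L ∈ X ∧ IsMinOn (fun x => η * ⟪x, L⟫ + R x) X (p L))
    {D S : ℝ} (hD : ∀ x ∈ X, ∀ y ∈ X, R x - R y ≤ D) {l : ℕ → Vec N} {T : ℕ}
    (hS : ∀ t ∈ Finset.Icc 1 T, ∀ L, ⟪l t, p L - p (L + l t)⟫ ≤ S) (z : Vec N)
    {u : Vec N} (hu : u ∈ X) :
    ∑ t ∈ Finset.Icc 1 T, ⟪l t, p (∑ s ∈ Finset.Icc 1 (t - 1), l s + z)⟫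
        - ∑ t ∈ Finset.Icc 1 T, ⟪l t, u⟫ ≤ D / η + ⟪u - p z, z⟫ + T * S := by
  have h1 := be_the_leader hp l z T hu
  have h2 : ∑ t ∈ Finset.Icc 1 T, ⟪l t, p (∑ s ∈ Finset.Icc 1 (t - 1), l s + z)⟫ ≤
      ∑ t ∈ Finset.Icc 1 T, ⟪l t, p (∑ s ∈ Finset.Icc 1 t, l s + z)⟫ + T * S := by
    have : (T : ℝ) * S = ∑ t ∈ Finset.Icc 1 T, S := by simp
    rw [this, ← Finset.sum_add_distrib]
    refine Finset.sum_le_sum fun t ht => ?_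
    have h := hS t ht (∑ s ∈ Finset.Icc 1 (t - 1), l s + z)
    obtain ⟨k, rfl⟩ : ∃ k, t = k + 1 := ⟨t - 1, by have := (Finset.mem_Icc.1 ht).1; omega⟩
    have e : ∑ s ∈ Finset.Icc 1 (k + 1), l s = ∑ s ∈ Finset.Icc 1 k, l s + l (k + 1) :=
      Finset.sum_Icc_succ_top (by omega) _
    rw [e]
    simp only [Nat.add_sub_cancel] at h ⊢
    rw [inner_sub_right, add_right_comm] at h
    linarith
  have h3 : ∑ t ∈ Finset.Icc 1 T, ⟪l t, u⟫ = ⟪u, ∑ s ∈ Finset.Icc 1 T, l s⟫ := by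
    rw [inner_sum]
    exact Finset.sum_congr rfl fun t _ => real_inner_comm _ _
  have h4 := hD u hu (p z) (hp z).1
  have h5 : η * (∑ t ∈ Finset.Icc 1 T, ⟪l t, p (∑ s ∈ Finset.Icc 1 t, l s + z)⟫
      - ⟪u, ∑ s ∈ Finset.Icc 1 T, l s⟫ - ⟪u - p z, z⟫) ≤ D := by
    rw [inner_add_right] at h1
    rw [inner_sub_left]
    linarith
  rw [← le_div_iff₀' hη] at h5
  linarith

/-- Passes from one fixed noise to the actual algorithm. Continuity of the leader gives
measurability in the noise, boundedness of `X` gives integrability, and `W` must dominate `⟪x - y,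
z⟫` uniformly because both the comparator and the leader at `z` vary. -/
theorem regretLE_of_stable {N : ℕ} {X : Set (Vec N)} (hX : Bornology.IsBounded X)
    {R : Vec N → ℝ} {η : ℝ} (hη : 0 < η)
    (hp : ∀ L, leader X R η L ∈ X ∧ IsMinOn (fun x => η * ⟪x, L⟫ + R x) X (leader X R η L))
    (hc : Continuous (leader X R η))
    {D S : ℝ} (hD : ∀ x ∈ X, ∀ y ∈ X, R x - R y ≤ D) {l : ℕ → Vec N} {T : ℕ} (hT : 1 ≤ T)
    (hS : ∀ t ∈ Finset.Icc 1 T, ∀ L, ⟪l t, leader X R η L - leader X R η (L + l t)⟫ ≤ S)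
    {lam w : ℝ} {W : Vec N → ℝ} (hW : ∀ x ∈ X, ∀ y ∈ X, ∀ z, ⟪x - y, z⟫ ≤ W z)
    (hWi : Integrable W (laplaceVec N lam)) (hw : ∫ z, W z ∂(laplaceVec N lam) ≤ w) {B : ℝ}
    (hB : D / η + Nat.clog 2 T * w + T * S ≤ B) :
    RegretLE X R η lam T l B := by
  have hprob : IsProbabilityMeasure (noise N lam) := by unfold noise; infer_instance
  set p := leader X R η with hpdef
  obtain ⟨K, hK⟩ := hX.exists_norm_le
  have hcont : ∀ t, Continuous fun z : Vec N =>
      (⟪l t, p (∑ s ∈ Finset.Icc 1 (t - 1), l s + z)⟫ : ℝ) := fun t => by fun_prop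
  have hint : ∀ t, ∀ I : Finset NoiseId, Integrable (fun ω : NoiseId → Vec N =>
      (⟪l t, p (∑ s ∈ Finset.Icc 1 (t - 1), l s + ∑ i ∈ I, ω i)⟫ : ℝ)) (noise N lam) := by
    intro t I
    refine Integrable.of_bound (C := ‖l t‖ * K) ?_ (Filter.Eventually.of_forall fun ω => ?_)
    · exact ((hcont t).measurable.comp
        (by fun_prop : Measurable fun ω : NoiseId → Vec N => ∑ i ∈ I, ω i)).aestronglyMeasurable
    · refine (norm_inner_le_norm _ _).trans ?_
      exact mul_le_mul_of_nonneg_left (hK _ (hp _).1) (norm_nonneg _)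
  have hreal : realizedRegret X R η T l = fun ω =>
      ∑ t ∈ Finset.Icc 1 T, ⟪l t, p (∑ s ∈ Finset.Icc 1 (t - 1), l s
        + ∑ i ∈ noiseIds T (t - 1), ω i)⟫
      - sInf ((fun x => ∑ t ∈ Finset.Icc 1 T, ⟪l t, x⟫) '' X) := by
    funext ω
    simp only [realizedRegret, prediction, hpdef, leader, treeBasedAgg_eq]
  -- Round `t` uses the estimate of time `t - 1 < T`, so its noise has the same number of summands,
  -- hence the same law, as that of time `0`.
  have hswap : ∀ t ∈ Finset.Icc 1 T,
      ∫ ω, ⟪l t, p (∑ s ∈ Finset.Icc 1 (t - 1), l s + ∑ i ∈ noiseIds T (t - 1), ω i)⟫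
        ∂(noise N lam)
      = ∫ ω, ⟪l t, p (∑ s ∈ Finset.Icc 1 (t - 1), l s + ∑ i ∈ noiseIds T 0, ω i)⟫
        ∂(noise N lam) := by
    intro t ht
    obtain ⟨h1, h2⟩ := Finset.mem_Icc.1 ht
    have hlaw := map_sum_noise_eq (N := N) (lam := lam) (I := noiseIds T (t - 1))
      (J := noiseIds T 0) (by rw [card_noiseIds (by omega), card_noiseIds (by omega)])
    rw [← integral_map (φ := fun ω : NoiseId → Vec N => ∑ i ∈ noiseIds T (t - 1), ω i)
        (f := fun z => (⟪l t, p (∑ s ∈ Finset.Icc 1 (t - 1), l s + z)⟫ : ℝ))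
        (by fun_prop) (hcont t).aestronglyMeasurable, hlaw,
      integral_map (by fun_prop) (hcont t).aestronglyMeasurable]
  have hWint : ∀ i, Integrable (fun ω : NoiseId → Vec N => W (ω i)) (noise N lam) := fun i =>
    (measurePreserving_eval_infinitePi (fun _ : NoiseId => laplaceVec N lam) i).integrable_comp_of_integrable
      hWi
  have hWval : ∀ i, ∫ ω, W (ω i) ∂(noise N lam) = ∫ z, W z ∂(laplaceVec N lam) := by
    intro i
    have hme := measurePreserving_eval_infinitePi (fun _ : NoiseId => laplaceVec N lam) i
    rw [← hme.map_eq, integral_map hme.measurable.aemeasurable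
      (by rw [hme.map_eq]; exact hWi.aestronglyMeasurable)]
    rfl
  -- The inner product with the total noise splits into one term per noise vector, each at most `W`;
  -- no cancellation between them is used.
  have hpt : ∀ ω : NoiseId → Vec N,
      ∑ t ∈ Finset.Icc 1 T, ⟪l t, p (∑ s ∈ Finset.Icc 1 (t - 1), l s
        + ∑ i ∈ noiseIds T 0, ω i)⟫
      - sInf ((fun x => ∑ t ∈ Finset.Icc 1 T, ⟪l t, x⟫) '' X)
      ≤ D / η + ∑ i ∈ noiseIds T 0, W (ω i) + T * S := by
    intro ω
    rw [sub_le_comm]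
    refine le_csInf (Set.Nonempty.image _ ⟨p 0, (hp 0).1⟩) ?_
    rintro _ ⟨u, hu, rfl⟩
    rw [sub_le_comm]
    refine (regret_le_of_stable hη hp hD hS _ hu).trans ?_
    gcongr
    rw [inner_sum]
    exact Finset.sum_le_sum fun i _ => hW _ hu _ (hp _).1 _
  refine ⟨?_, ?_⟩
  · rw [hreal]
    exact (integrable_finsetSum _ fun t _ => hint t _).sub (integrable_const _)
  -- The swap is valid only for each round in expectation, so the sum is pulled out of the integral,
  -- changed term by term, and put back.
  · rw [hreal, integral_sub (integrable_finsetSum _ fun t _ => hint t _) (integrable_const _),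
      integral_finsetSum _ fun t _ => hint t _, Finset.sum_congr rfl hswap,
      ← integral_finsetSum _ fun t _ => hint t _,
      ← integral_sub (integrable_finsetSum _ fun t _ => hint t _) (integrable_const _)]
    have hSW : Integrable (fun ω : NoiseId → Vec N => ∑ i ∈ noiseIds T 0, W (ω i)) (noise N lam) :=
      integrable_finsetSum _ fun i _ => hWint i
    refine (integral_mono ((integrable_finsetSum _ fun t _ => hint t _).sub (integrable_const _))
      (((integrable_const _).add hSW).add (integrable_const _)) hpt).trans (le_trans ?_ hB)
    rw [integral_add' ((integrable_const _).add hSW) (integrable_const _),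
      integral_add' (integrable_const _) hSW, integral_finsetSum _ fun i _ => hWint i]
    simp only [hWval, integral_const, probReal_univ, one_smul, Finset.sum_const, nsmul_eq_mul,
      card_noiseIds (show 0 < T by omega)]
    gcongr

/-! ### Moments of the Laplace distribution -/

theorem laplace_eq_map (lam : ℝ) : laplace lam = (laplace 1).map fun x => lam * x := by
  rw [laplace, laplace, Measure.map_map (by fun_prop) (by fun_prop)]
  congr 1
  ext x
  simp

/-- Reduces moments to `lam = 1`, and covers `lam = 0`, which occurs for `T = 1`. -/
theorem laplaceVec_eq_map (N : ℕ) (lam : ℝ) :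
    laplaceVec N lam = (laplaceVec N 1).map fun z => lam • z := by
  rw [laplaceVec, laplaceVec, Measure.map_map (by fun_prop) (by fun_prop)]
  have h := Measure.pi_map_pi (μ := fun _ : Fin N => laplace 1) (f := fun _ x => lam * x)
    (hμ := fun _ => by rw [← laplace_eq_map]; infer_instance) (fun _ => by fun_prop)
  simp only [← laplace_eq_map] at h
  rw [← h, Measure.map_map (by fun_prop) (by fun_prop)]
  congr 1

theorem laplace_one : laplace 1 =
    volume.withDensity fun x => ENNReal.ofReal (stdLaplaceDensity x) := by
  simp [laplace, Measure.map_id']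

theorem integrable_exp_neg_half_abs : Integrable fun x : ℝ => Real.exp (-(|x| / 2)) := by
  refine Integrable.of_integral_ne_zero ?_
  rw [integral_comp_abs (f := fun x => Real.exp (-(x / 2)))]
  have := integral_exp_mul_Ioi (a := -(1 / 2 : ℝ)) (by norm_num) 0
  simp only [neg_mul, one_div_mul_eq_div] at this
  rw [this]
  norm_num

theorem stdLaplaceDensity_mul_exp (x : ℝ) :
    stdLaplaceDensity x * Real.exp (|x| / 2) = Real.exp (-(|x| / 2)) / 2 := by
  rw [stdLaplaceDensity, div_mul_eq_mul_div, ← Real.exp_add]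
  ring_nf

theorem measurable_stdLaplaceDensity : Measurable stdLaplaceDensity := by
  unfold stdLaplaceDensity
  fun_prop

theorem stdLaplaceDensity_nonneg (x : ℝ) : 0 ≤ stdLaplaceDensity x := by
  unfold stdLaplaceDensity
  positivity

theorem integrable_exp_half_abs_laplace :
    Integrable (fun x => Real.exp (|x| / 2)) (laplace 1) := by
  rw [laplace_one, integrable_withDensity_iff (by have := measurable_stdLaplaceDensity; fun_prop)
    (by simp)]
  refine (integrable_exp_neg_half_abs.div_const 2).congr (Filter.Eventually.of_forall fun x => ?_)
  simp only
  rw [ENNReal.toReal_ofReal (stdLaplaceDensity_nonneg x), mul_comm, stdLaplaceDensity_mul_exp]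

/-- The weight `exp (|x| / 2)` halves the decay rate of the density and thus doubles its mass. -/
theorem integral_exp_half_abs_laplace : ∫ x, Real.exp (|x| / 2) ∂(laplace 1) = 2 := by
  rw [laplace_one, integral_withDensity_eq_integral_toReal_smul
    (by have := measurable_stdLaplaceDensity; fun_prop) (by simp)]
  simp only [ENNReal.toReal_ofReal (stdLaplaceDensity_nonneg _), smul_eq_mul,
    stdLaplaceDensity_mul_exp]
  rw [integral_div, integral_comp_abs (f := fun x => Real.exp (-(x / 2)))]
  have := integral_exp_mul_Ioi (a := -(1 / 2 : ℝ)) (by norm_num) 0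
  simp only [neg_mul, one_div_mul_eq_div] at this
  rw [this]
  norm_num

/-- The sum of the exponential moments of the coordinates. -/
noncomputable def expSum {N : ℕ} (z : Vec N) : ℝ := ∑ i, Real.exp (|z i| / 2)

theorem measurePreserving_coord (N : ℕ) (i : Fin N) :
    MeasurePreserving (fun z : Vec N => z i) (laplaceVec N 1) (laplace 1) := by
  refine ⟨by fun_prop, ?_⟩
  rw [laplaceVec, Measure.map_map (by fun_prop) (by fun_prop)]
  exact (measurePreserving_eval (fun _ : Fin N => laplace 1) i).map_eq

theorem integrable_expSum (N : ℕ) : Integrable (expSum (N := N)) (laplaceVec N 1) :=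
  integrable_finsetSum _ fun i _ =>
    (measurePreserving_coord N i).integrable_comp_of_integrable integrable_exp_half_abs_laplace

theorem integral_expSum (N : ℕ) : ∫ z, expSum z ∂(laplaceVec N 1) = 2 * N := by
  have hi : ∀ i : Fin N, Integrable (fun z : Vec N => Real.exp (|z i| / 2)) (laplaceVec N 1) :=
    fun i => (measurePreserving_coord N i).integrable_comp_of_integrable
      integrable_exp_half_abs_laplace
  unfold expSum
  rw [integral_finsetSum _ fun i _ => hi i]
  have : ∀ i : Fin N, ∫ z : Vec N, Real.exp (|z i| / 2) ∂(laplaceVec N 1) = 2 := fun i => by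
    have hme := measurePreserving_coord N i
    refine Eq.trans ?_ integral_exp_half_abs_laplace
    rw [← hme.map_eq, integral_map hme.measurable.aemeasurable (by fun_prop)]
  simp [this, mul_comm]

/-- A nonnegatively homogeneous function that is dominated by the exponential moments under the
standard Laplace law. -/
theorem integral_laplaceVec_le {N : ℕ} {lam : ℝ} (hlam : 0 ≤ lam) {W : Vec N → ℝ}
    (hc : Continuous W) (h0 : ∀ z, 0 ≤ W z) (hhom : ∀ c : ℝ, 0 ≤ c → ∀ z, W (c • z) = c * W z)
    {a b : ℝ} (hW : ∀ z, W z ≤ a + b * expSum z) :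
    Integrable W (laplaceVec N lam) ∧
      ∫ z, W z ∂(laplaceVec N lam) ≤ lam * (a + b * (2 * N)) := by
  have hdom : Integrable (fun z : Vec N => a + b * expSum z) (laplaceVec N 1) :=
    (integrable_const _).add ((integrable_expSum N).const_mul b)
  have hi : Integrable W (laplaceVec N 1) :=
    hdom.mono' hc.aestronglyMeasurable (Filter.Eventually.of_forall fun z => by
      rw [Real.norm_of_nonneg (h0 z)]; exact hW z)
  rw [laplaceVec_eq_map]
  refine ⟨(integrable_map_measure hc.aestronglyMeasurable (by fun_prop)).2 ?_, ?_⟩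
  · exact (hi.const_mul lam).congr (Filter.Eventually.of_forall fun z => (hhom lam hlam z).symm)
  · rw [integral_map (by fun_prop) hc.aestronglyMeasurable]
    simp only [hhom lam hlam, integral_const_mul]
    gcongr
    refine (integral_mono hi hdom hW).trans (le_of_eq ?_)
    rw [integral_add (integrable_const _) ((integrable_expSum N).const_mul b),
      integral_const_mul, integral_expSum]
    simp

theorem sum_abs_le_expSum {N : ℕ} (z : Vec N) : ∑ i, |z i| ≤ 2 * expSum z := by
  rw [expSum, Finset.mul_sum]
  refine Finset.sum_le_sum fun i _ => ?_
  linarith [Real.add_one_le_exp (|z i| / 2)]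

/-- AM-GM with scale `√N` replaces `‖z‖` by `‖z‖ ^ 2`, and `s ^ 2 / 8 ≤ exp (s / 2)` for `s ≥ 0`.
The mean of the right-hand side is of order `√N`. -/
theorem norm_le_expSum {N : ℕ} (hN : 1 ≤ N) (z : Vec N) :
    ‖z‖ ≤ √N / 2 + 4 / √N * expSum z := by
  have hN' : (0 : ℝ) < √N := Real.sqrt_pos.2 (by exact_mod_cast hN)
  have h1 : ‖z‖ ^ 2 ≤ 8 * expSum z := by
    rw [EuclideanSpace.norm_sq_eq, expSum, Finset.mul_sum]
    refine Finset.sum_le_sum fun i _ => ?_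
    have := Real.quadratic_le_exp_of_nonneg (x := |z i| / 2) (by positivity)
    have h := abs_nonneg (z i)
    rw [Real.norm_eq_abs]
    nlinarith
  have h2 : ‖z‖ ≤ √N / 2 + ‖z‖ ^ 2 / (2 * √N) := by
    have : √N / 2 + ‖z‖ ^ 2 / (2 * √N) - ‖z‖ = (√N - ‖z‖) ^ 2 / (2 * √N) := by
      field_simp; ring
    have : 0 ≤ (√N - ‖z‖) ^ 2 / (2 * √N) := by positivity
    linarith
  have h3 : ‖z‖ ^ 2 / (2 * √N) ≤ 8 * expSum z / (2 * √N) := by gcongr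
  have h4 : 8 * expSum z / (2 * √N) = 4 / √N * expSum z := by field_simp; ring
  linarith

/-- A single coordinate's exponential is at most `expSum z`; then `exp` is bounded below by its
tangent at `log (2 * N)`, the logarithm of the mean of `expSum`. -/
theorem supNorm_le_expSum {N : ℕ} (hN : 1 ≤ N) (z : Vec N) :
    ‖WithLp.ofLp z‖ ≤ (2 * Real.log (2 * N) - 2) + 1 / N * expSum z := by
  have hN' : (0 : ℝ) < N := by exact_mod_cast hN
  have hne : Nonempty (Fin N) := ⟨⟨0, hN⟩⟩
  refine (pi_norm_le_iff_of_nonempty _).2 fun i => ?_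
  rw [Real.norm_eq_abs]
  have h1 : Real.exp (|z i| / 2) ≤ expSum z :=
    Finset.single_le_sum (f := fun i => Real.exp (|z i| / 2)) (fun _ _ => by positivity)
      (Finset.mem_univ i)
  have h2 := Real.add_one_le_exp (|z i| / 2 - Real.log (2 * N))
  rw [Real.exp_sub, Real.exp_log (by positivity)] at h2
  have h3 : Real.exp (|z i| / 2) / (2 * N) ≤ expSum z / (2 * N) := by gcongr
  have h4 : expSum z / (2 * N) = 1 / N * expSum z / 2 := by field_simp
  linarith

/-! ### The squared Euclidean norm as regularizer -/

theorem leader_sqReg_spec {N : ℕ} {X : Set (Vec N)} (hX : IsCompact X) (hne : X.Nonempty) (η : ℝ)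
    (L : Vec N) : leader X sqReg η L ∈ X ∧
      IsMinOn (fun x => η * ⟪x, L⟫ + sqReg x) X (leader X sqReg η L) :=
  argminOn_spec (hX.exists_isMinOn hne (by unfold sqReg; fun_prop))

/-- Minimality is tested at the midpoint of `x` and `y`, where the parallelogram law gains `‖x - y‖
^ 2 / 4`. -/
theorem sqReg_growth {N : ℕ} {X : Set (Vec N)} (hX : Convex ℝ X) {η : ℝ} {L x y : Vec N}
    (hx : x ∈ X) (hy : y ∈ X) (hmin : IsMinOn (fun x => η * ⟪x, L⟫ + sqReg x) X x) :
    η * ⟪x, L⟫ + sqReg x + ‖x - y‖ ^ 2 / 2 ≤ η * ⟪y, L⟫ + sqReg y := by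
  have hm : (1 / 2 : ℝ) • x + (1 / 2 : ℝ) • y ∈ X :=
    hX hx hy (by norm_num) (by norm_num) (by norm_num)
  have h : η * ⟪x, L⟫ + sqReg x ≤ η * ⟪(1 / 2 : ℝ) • x + (1 / 2 : ℝ) • y, L⟫
      + sqReg ((1 / 2 : ℝ) • x + (1 / 2 : ℝ) • y) := hmin hm
  simp only [sqReg] at h ⊢
  rw [← smul_add, norm_smul, mul_pow, norm_add_sq_real, inner_smul_left, inner_add_left] at h
  rw [norm_sub_sq_real]
  norm_num at h
  linarith

/-- Adding the growth inequalities of the two minimizers, each tested at the other, cancels the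
regularizer. This gives both stability and continuity. -/
theorem leader_sqReg_lipschitz {N : ℕ} {X : Set (Vec N)} (hX : IsCompact X) (hne : X.Nonempty)
    (hconv : Convex ℝ X) {η : ℝ} (hη : 0 < η) (L L' : Vec N) :
    ‖leader X sqReg η L - leader X sqReg η L'‖ ≤ η * ‖L - L'‖ := by
  obtain ⟨hx, hxm⟩ := leader_sqReg_spec hX hne η L
  obtain ⟨hy, hym⟩ := leader_sqReg_spec hX hne η L'
  generalize leader X sqReg η L = x at *
  generalize leader X sqReg η L' = y at *
  have h1 := sqReg_growth hconv hx hy hxm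
  have h2 := sqReg_growth hconv hy hx hym
  rw [norm_sub_rev y x] at h2
  have h3 : ‖x - y‖ ^ 2 ≤ η * ⟪y - x, L - L'⟫ := by
    simp only [inner_sub_left, inner_sub_right]
    linarith
  have h4 : ⟪y - x, L - L'⟫ ≤ ‖x - y‖ * ‖L - L'‖ := by
    rw [norm_sub_rev x y]
    exact real_inner_le_norm _ _
  have h5 : η * ⟪y - x, L - L'⟫ ≤ η * (‖x - y‖ * ‖L - L'‖) := by gcongr
  rcases (norm_nonneg (x - y)).eq_or_lt with h | h
  · rw [← h]
    positivity
  · refine le_of_mul_le_mul_left ?_ h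
    linarith

theorem continuous_leader_sqReg {N : ℕ} {X : Set (Vec N)} (hX : IsCompact X) (hne : X.Nonempty)
    (hconv : Convex ℝ X) {η : ℝ} (hη : 0 < η) : Continuous (leader X sqReg η) := by
  refine (LipschitzWith.of_dist_le_mul (K := ⟨η, hη.le⟩) fun L L' => ?_).continuous
  rw [dist_eq_norm, dist_eq_norm]
  exact leader_sqReg_lipschitz hX hne hconv hη L L'

theorem leader_sqReg_stable {N : ℕ} {X : Set (Vec N)} (hX : IsCompact X) (hne : X.Nonempty)
    (hconv : Convex ℝ X) {η : ℝ} (hη : 0 < η) {v : Vec N} (hv : ‖v‖ ≤ 1) (L : Vec N) :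
    ⟪v, leader X sqReg η L - leader X sqReg η (L + v)⟫ ≤ η := by
  have h := leader_sqReg_lipschitz hX hne hconv hη L (L + v)
  rw [sub_add_cancel_left, norm_neg] at h
  calc _ ≤ ‖v‖ * ‖leader X sqReg η L - leader X sqReg η (L + v)‖ := real_inner_le_norm _ _
    _ ≤ ‖v‖ * (η * ‖v‖) := by gcongr
    _ ≤ 1 * (η * 1) := by gcongr
    _ = η := by ring

theorem regretLE_sqReg {N : ℕ} {X : Set (Vec N)} (hX : IsCompact X) (hne : X.Nonempty)
    (hconv : Convex ℝ X) {η : ℝ} (hη : 0 < η) {D : ℝ} (hD : ∀ x ∈ X, ‖x‖ ^ 2 ≤ D)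
    {l : ℕ → Vec N} {T : ℕ} (hT : 1 ≤ T) (hl : ∀ t ∈ Finset.Icc 1 T, ‖l t‖ ≤ 1)
    {lam w : ℝ} {W : Vec N → ℝ} (hW : ∀ x ∈ X, ∀ y ∈ X, ∀ z, ⟪x - y, z⟫ ≤ W z)
    (hWi : Integrable W (laplaceVec N lam) ∧ ∫ z, W z ∂(laplaceVec N lam) ≤ w) {B : ℝ}
    (hB : D / η + Nat.clog 2 T * w + T * η ≤ B) :
    RegretLE X sqReg η lam T l B :=
  regretLE_of_stable hX.isBounded hη (leader_sqReg_spec hX hne η)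
    (continuous_leader_sqReg hX hne hconv hη)
    (fun x hx y _ => by have := hD x hx; have := sq_nonneg ‖y‖; simp only [sqReg]; linarith)
    hT (fun t ht => leader_sqReg_stable hX hne hconv hη (hl t ht)) hW hWi.1 hWi.2 hB

/-! ### Negative entropy as regularizer -/

/-- The exponential weights distribution. -/
noncomputable def expWeights {N : ℕ} (η : ℝ) (L : Vec N) : Vec N :=
  WithLp.toLp 2 fun i => Real.exp (-(η * L i)) / ∑ j, Real.exp (-(η * L j))

theorem sum_exp_pos {N : ℕ} (hN : 1 ≤ N) (f : Fin N → ℝ) : 0 < ∑ j, Real.exp (f j) :=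
  Finset.sum_pos (fun _ _ => Real.exp_pos _) ⟨⟨0, hN⟩, Finset.mem_univ _⟩

theorem expWeights_pos {N : ℕ} (hN : 1 ≤ N) (η : ℝ) (L : Vec N) (i : Fin N) :
    0 < expWeights η L i :=
  div_pos (Real.exp_pos _) (sum_exp_pos hN _)

theorem expWeights_mem_simplex {N : ℕ} (hN : 1 ≤ N) (η : ℝ) (L : Vec N) :
    expWeights η L ∈ simplex N := by
  refine ⟨fun i => (expWeights_pos hN η L i).le, ?_⟩
  simp only [expWeights]
  rw [← Finset.sum_div, div_self (sum_exp_pos hN _).ne']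

/-- The Gibbs variational principle. -/
theorem entropic_objective_eq {N : ℕ} (hN : 1 ≤ N) (η : ℝ) (L : Vec N) {x : Vec N}
    (hx : x ∈ simplex N) :
    η * ⟪x, L⟫ + entropicReg x
      = ∑ i, expWeights η L i * InformationTheory.klFun (x i / expWeights η L i)
        - Real.log (∑ j, Real.exp (-(η * L j))) := by
  have hZ := sum_exp_pos hN fun j => -(η * L j)
  have hlog : ∀ i, Real.log (expWeights η L i)
      = -(η * L i) - Real.log (∑ j, Real.exp (-(η * L j))) := fun i => by
    simp only [expWeights]
    rw [Real.log_div (Real.exp_pos _).ne' hZ.ne', Real.log_exp]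
  have hterm : ∀ i, expWeights η L i * InformationTheory.klFun (x i / expWeights η L i)
      = η * (x i * L i) + x i * Real.log (x i)
        + x i * Real.log (∑ j, Real.exp (-(η * L j))) + (expWeights η L i - x i) := by
    intro i
    have hp := expWeights_pos hN η L i
    rw [InformationTheory.klFun_apply]
    rcases eq_or_ne (x i) 0 with h0 | h0
    · simp [h0]
    · rw [Real.log_div h0 hp.ne', hlog]
      field_simp
      ring
  have hin : ⟪x, L⟫ = ∑ i, x i * L i := by
    rw [PiLp.inner_apply]
    exact Finset.sum_congr rfl fun i _ => by simp [mul_comm]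
  simp only [hterm, Finset.sum_add_distrib, Finset.sum_sub_distrib, ← Finset.mul_sum,
    ← Finset.sum_mul]
  rw [hx.2, (expWeights_mem_simplex hN η L).2, hin, entropicReg]
  ring

theorem entropic_objective_expWeights {N : ℕ} (hN : 1 ≤ N) (η : ℝ) (L : Vec N) :
    η * ⟪expWeights η L, L⟫ + entropicReg (expWeights η L)
      = - Real.log (∑ j, Real.exp (-(η * L j))) := by
  rw [entropic_objective_eq hN η L (expWeights_mem_simplex hN η L)]
  simp [div_self (expWeights_pos hN η L _).ne', InformationTheory.klFun_one]

theorem isMinOn_expWeights {N : ℕ} (hN : 1 ≤ N) (η : ℝ) (L : Vec N) :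
    IsMinOn (fun x => η * ⟪x, L⟫ + entropicReg x) (simplex N) (expWeights η L) := by
  intro x hx
  simp only [Set.mem_ofPred_eq]
  rw [entropic_objective_expWeights hN, entropic_objective_eq hN η L hx]
  have : 0 ≤ ∑ i, expWeights η L i * InformationTheory.klFun (x i / expWeights η L i) :=
    Finset.sum_nonneg fun i _ => mul_nonneg (expWeights_pos hN η L i).le
      (InformationTheory.klFun_nonneg (div_nonneg (hx.1 i) (expWeights_pos hN η L i).le))
  linarith

/-- `argminOn` picks an arbitrary minimizer, so uniqueness is needed: a minimizer has zero
divergence, and `klFun` vanishes only at `1`. -/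
theorem leader_entropicReg {N : ℕ} (hN : 1 ≤ N) (η : ℝ) :
    leader (simplex N) entropicReg η = expWeights η := by
  funext L
  obtain ⟨hx, hmin⟩ := argminOn_spec (f := fun x : Vec N => η * ⟪x, L⟫ + entropicReg x)
    ⟨_, expWeights_mem_simplex hN η L, isMinOn_expWeights hN η L⟩
  change leader (simplex N) entropicReg η L ∈ _ at hx
  have h : η * ⟪leader (simplex N) entropicReg η L, L⟫
      + entropicReg (leader (simplex N) entropicReg η L)
      ≤ η * ⟪expWeights η L, L⟫ + entropicReg (expWeights η L) :=
    hmin (expWeights_mem_simplex hN η L)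
  generalize leader (simplex N) entropicReg η L = x at hx h
  rw [entropic_objective_expWeights hN, entropic_objective_eq hN η L hx] at h
  have hnn : ∀ i ∈ Finset.univ,
      0 ≤ expWeights η L i * InformationTheory.klFun (x i / expWeights η L i) := fun i _ =>
    mul_nonneg (expWeights_pos hN η L i).le
      (InformationTheory.klFun_nonneg (div_nonneg (hx.1 i) (expWeights_pos hN η L i).le))
  have h0 := (Finset.sum_eq_zero_iff_of_nonneg hnn).1
    (le_antisymm (by linarith) (Finset.sum_nonneg hnn))
  ext i
  have hp := expWeights_pos hN η L i
  have h1 := (mul_eq_zero.1 (h0 i (Finset.mem_univ i))).resolve_left hp.ne'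
  rwa [InformationTheory.klFun_eq_zero_iff (div_nonneg (hx.1 i) hp.le), div_eq_one_iff_eq hp.ne']
    at h1

theorem continuous_expWeights {N : ℕ} (hN : 1 ≤ N) (η : ℝ) :
    Continuous (expWeights (N := N) η) := by
  unfold expWeights
  refine (PiLp.continuous_toLp 2 _).comp (continuous_pi fun i => ?_)
  exact Continuous.div (by fun_prop) (by fun_prop) fun L => (sum_exp_pos hN _).ne'

theorem entropicReg_nonpos {N : ℕ} {x : Vec N} (hx : x ∈ simplex N) : entropicReg x ≤ 0 := by
  refine Finset.sum_nonpos fun i _ => Real.mul_log_nonpos (hx.1 i) ?_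
  rw [← hx.2]
  exact Finset.single_le_sum (fun j _ => hx.1 j) (Finset.mem_univ i)

theorem neg_log_le_entropicReg {N : ℕ} (hN : 1 ≤ N) {x : Vec N} (hx : x ∈ simplex N) :
    -Real.log N ≤ entropicReg x := by
  -- With zero loss the minimum value of the entropy is `-log N`.
  have h := isMinOn_expWeights hN 0 0 hx
  simp only [Set.mem_ofPred_eq] at h
  rw [entropic_objective_expWeights hN] at h
  simpa using h

/-- The numerator shrinks by at most `exp (-η)` and the normalization grows by at most `exp η`; then
`1 - 2 * η ≤ exp (-(2 * η))`. -/
theorem le_expWeights_add {N : ℕ} (hN : 1 ≤ N) {η : ℝ} (hη : 0 < η) (L : Vec N) {v : Vec N}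
    (hv : v ∈ cube N) (i : Fin N) :
    (1 - 2 * η) * expWeights η L i ≤ expWeights η (L + v) i := by
  have hp := expWeights_pos hN η L i
  have hZ := sum_exp_pos hN fun j => -(η * L j)
  have hZ' := sum_exp_pos hN fun j => -(η * (L + v) j)
  have h1 : Real.exp (-η) * Real.exp (-(η * L i)) ≤ Real.exp (-(η * (L + v) i)) := by
    rw [← Real.exp_add]
    refine Real.exp_le_exp.2 ?_
    have := (abs_le.1 (hv i)).2
    rw [PiLp.add_apply]
    nlinarith
  have h2 : ∑ j, Real.exp (-(η * (L + v) j)) ≤ Real.exp η * ∑ j, Real.exp (-(η * L j)) := by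
    rw [Finset.mul_sum]
    refine Finset.sum_le_sum fun j _ => ?_
    rw [← Real.exp_add]
    refine Real.exp_le_exp.2 ?_
    have := (abs_le.1 (hv j)).1
    rw [PiLp.add_apply]
    nlinarith
  have h3 : Real.exp (-η) * Real.exp (-(η * L i)) / (Real.exp η * ∑ j, Real.exp (-(η * L j)))
      ≤ expWeights η (L + v) i := by
    simp only [expWeights]
    gcongr
  have h4 : Real.exp (-η) * Real.exp (-(η * L i)) / (Real.exp η * ∑ j, Real.exp (-(η * L j)))
      = Real.exp (-(2 * η)) * expWeights η L i := by
    simp only [expWeights]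
    rw [mul_div_mul_comm, ← Real.exp_sub]
    ring_nf
  rw [h4] at h3
  refine le_trans ?_ h3
  gcongr
  linarith [Real.add_one_le_exp (-(2 * η))]

theorem expWeights_stable {N : ℕ} (hN : 1 ≤ N) {η : ℝ} (hη : 0 < η) {v : Vec N}
    (hv : v ∈ cube N) (L : Vec N) :
    ⟪v, expWeights η L - expWeights η (L + v)⟫ ≤ 4 * η := by
  have h1 := (expWeights_mem_simplex hN η L).2
  have h2 := (expWeights_mem_simplex hN η (L + v)).2
  -- The weight differences sum to `0`, so `v` may be shifted by `1`. Its coordinates then lie in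
  -- `[0, 2]`, and the one-sided bound `le_expWeights_add` suffices.
  have hin : ⟪v, expWeights η L - expWeights η (L + v)⟫
      = ∑ i, (v i + 1) * (expWeights η L i - expWeights η (L + v) i) := by
    simp only [add_mul, one_mul, Finset.sum_add_distrib, Finset.sum_sub_distrib, h1, h2]
    rw [PiLp.inner_apply, sub_self, add_zero]
    exact Finset.sum_congr rfl fun i _ => by simp [mul_comm]
  have hr : 4 * η = ∑ i, 4 * η * expWeights η L i := by rw [← Finset.mul_sum, h1, mul_one]
  rw [hin, hr]
  refine Finset.sum_le_sum fun i _ => ?_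
  have hp := expWeights_pos hN η L i
  have h := le_expWeights_add hN hη L hv i
  obtain ⟨ha, hb⟩ := abs_le.1 (hv i)
  calc (v i + 1) * (expWeights η L i - expWeights η (L + v) i)
      ≤ (v i + 1) * (2 * η * expWeights η L i) :=
        mul_le_mul_of_nonneg_left (by linarith) (by linarith)
    _ ≤ 2 * (2 * η * expWeights η L i) :=
        mul_le_mul_of_nonneg_right (by linarith) (by positivity)
    _ = 4 * η * expWeights η L i := by ring

theorem isBounded_simplex (N : ℕ) : Bornology.IsBounded (simplex N) := by
  refine isBounded_iff_forall_norm_le.2 ⟨√N, fun x hx => ?_⟩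
  rw [EuclideanSpace.norm_eq]
  refine Real.sqrt_le_sqrt ?_
  have : ∀ i, ‖x i‖ ^ 2 ≤ 1 := fun i => by
    have h : x i ≤ 1 := by
      rw [← hx.2]
      exact Finset.single_le_sum (fun j _ => hx.1 j) (Finset.mem_univ i)
    rw [Real.norm_eq_abs, sq_abs]
    have := hx.1 i
    nlinarith
  calc _ ≤ ∑ _i : Fin N, (1 : ℝ) := Finset.sum_le_sum fun i _ => this i
    _ = N := by simp

/-- Hölder's inequality on the simplex. -/
theorem inner_sub_le_of_mem_simplex {N : ℕ} {x y : Vec N} (hx : x ∈ simplex N)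
    (hy : y ∈ simplex N) (z : Vec N) : ⟪x - y, z⟫ ≤ 2 * ‖WithLp.ofLp z‖ := by
  have h : ∀ i, |z i| ≤ ‖WithLp.ofLp z‖ := fun i => norm_le_pi_norm (WithLp.ofLp z) i
  have hxz : ∑ i, x i * z i ≤ ∑ i, x i * ‖WithLp.ofLp z‖ :=
    Finset.sum_le_sum fun i _ => mul_le_mul_of_nonneg_left ((le_abs_self _).trans (h i)) (hx.1 i)
  have hyz : ∑ i, y i * (-‖WithLp.ofLp z‖) ≤ ∑ i, y i * z i :=
    Finset.sum_le_sum fun i _ => mul_le_mul_of_nonneg_left (abs_le.1 (h i)).1 (hy.1 i)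
  rw [← Finset.sum_mul, hx.2] at hxz
  rw [← Finset.sum_mul, hy.2] at hyz
  have hin : ⟪x - y, z⟫ = ∑ i, x i * z i - ∑ i, y i * z i := by
    rw [PiLp.inner_apply, ← Finset.sum_sub_distrib]
    exact Finset.sum_congr rfl fun i _ => by simp [mul_comm, sub_mul]
  linarith

/-! ### The three applications -/

theorem clog_le_two_mul_logb {T : ℕ} (hT : 1 ≤ T) : (Nat.clog 2 T : ℝ) ≤ 2 * Real.logb 2 T := by
  rcases hT.eq_or_lt with rfl | h
  · simp
  · have h1 : (Nat.clog 2 T : ℝ) ≤ Nat.log 2 T + 1 := by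
      exact_mod_cast Nat.clog_le_of_le_pow (Nat.lt_pow_succ_log_self one_lt_two T).le
    have h2 := Real.natLog_le_logb T 2
    have h3 : 1 ≤ Real.logb 2 T := by
      rw [Real.le_logb_iff_rpow_le (by norm_num) (by exact_mod_cast hT)]
      simpa using (by exact_mod_cast h : (2 : ℝ) ≤ T)
    push_cast at h2
    linarith

theorem logb_two_sq_le (x : ℝ) : Real.logb 2 x ^ 2 ≤ 3 * Real.log x ^ 2 := by
  have h := Real.log_two_gt_d9
  rw [Real.logb, div_pow, div_le_iff₀ (by positivity)]
  have : 1 ≤ 3 * Real.log 2 ^ 2 := by nlinarith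
  nlinarith [sq_nonneg (Real.log x)]

/-- `K` stands for the mean of `W` at `lam = 1`. The constant is `6 = 2 * 3`, from
`clog_le_two_mul_logb` and `logb_two_sq_le`. -/
theorem clog_mul_noise_le {T : ℕ} (hT : 1 ≤ T) {a K ε : ℝ} (ha : 0 ≤ a) (hK : 0 ≤ K)
    (hε : 0 < ε) :
    Nat.clog 2 T * (a * Real.logb 2 T / ε * K) ≤ 6 * (a * K * Real.log T ^ 2 / ε) := by
  have h0 : 0 ≤ Real.logb 2 T := Real.logb_nonneg (by norm_num) (by exact_mod_cast hT)
  calc Nat.clog 2 T * (a * Real.logb 2 T / ε * K)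
      ≤ 2 * Real.logb 2 T * (a * Real.logb 2 T / ε * K) := by
        gcongr
        exact clog_le_two_mul_logb hT
    _ = 2 * (a * K * Real.logb 2 T ^ 2 / ε) := by ring
    _ ≤ 2 * (a * K * (3 * Real.log T ^ 2) / ε) := by
        gcongr
        exact logb_two_sq_le _
    _ = 6 * (a * K * Real.log T ^ 2 / ε) := by ring

theorem noise_scale_nonneg {T : ℕ} (hT : 1 ≤ T) {a ε : ℝ} (ha : 0 ≤ a) (hε : 0 < ε) :
    0 ≤ a * Real.logb 2 T / ε := by
  have h0 : 0 ≤ Real.logb 2 T := Real.logb_nonneg (by norm_num) (by exact_mod_cast hT)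
  positivity

/-- The step size `√(D / T)` balances `D / η` and `T * η`. -/
theorem step_size_balance {D : ℝ} (hD : 0 < D) {T : ℕ} (hT : 1 ≤ T) :
    0 < √(D / T) ∧ D / √(D / T) = √(T * D) ∧ T * √(D / T) = √(T * D) := by
  have hT' : (0 : ℝ) < T := by exact_mod_cast hT
  have hsD := Real.sqrt_pos.2 hD
  have hsT := Real.sqrt_pos.2 hT'
  have e1 := Real.mul_self_sqrt hD.le
  have e2 := Real.mul_self_sqrt hT'.le
  refine ⟨Real.sqrt_pos.2 (by positivity), ?_, ?_⟩
  · rw [Real.sqrt_div hD.le, Real.sqrt_mul hT'.le, div_div_eq_mul_div, div_eq_iff hsD.ne']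
    nth_rewrite 1 [← e1]
    ring
  · rw [Real.sqrt_div hD.le, Real.sqrt_mul hT'.le, mul_div_assoc', div_eq_iff hsT.ne']
    nth_rewrite 1 [← e2]
    ring

/-! ### The Euclidean ball. -/

theorem regretLE_ball2 {N T : ℕ} (hN : 1 ≤ N) (hT : 1 ≤ T) {ε : ℝ} (hε : 0 < ε)
    {l : ℕ → Vec N} (hl : ∀ t ∈ Finset.Icc 1 T, l t ∈ ball2 N) :
    RegretLE (ball2 N) sqReg √(1 / T) (√N * Real.logb 2 T / ε) T l
      (102 * (√T + N * Real.log T ^ 2 / ε)) := by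
  have hball : ball2 N = Metric.closedBall 0 1 := by ext x; simp [ball2]
  have hN' : (0 : ℝ) < √N := Real.sqrt_pos.2 (by exact_mod_cast hN)
  have hNN : √(N : ℝ) * √N = N := Real.mul_self_sqrt (by positivity)
  obtain ⟨hη, e1, e2⟩ := step_size_balance one_pos hT
  refine regretLE_sqReg (X := ball2 N) (hball ▸ isCompact_closedBall 0 1)
    ⟨0, by simp [hball]⟩ (hball ▸ convex_closedBall 0 1) hη
    (D := 1) (fun x hx => pow_le_one₀ (norm_nonneg x) hx) hT hl (W := fun z => 2 * ‖z‖)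
    (fun x hx y hy z => ?_)
    (integral_laplaceVec_le (noise_scale_nonneg hT hN'.le hε) (by fun_prop)
      (fun z => by positivity) (fun c hc z => ?_) (a := √N) (b := 8 / √N) (fun z => ?_)) ?_
  · refine (real_inner_le_norm _ _).trans ?_
    gcongr
    have h1 : ‖x‖ ≤ 1 := hx
    have h2 : ‖y‖ ≤ 1 := hy
    linarith [norm_sub_le x y]
  · rw [norm_smul, Real.norm_of_nonneg hc]
    ring
  · refine (mul_le_mul_of_nonneg_left (norm_le_expSum hN z) two_pos.le).trans (le_of_eq ?_)
    ring
  -- The factor `17 = 1 + 8 * 2` gives the final constant `102 = 6 * 17`.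
  · have hK : √N + 8 / √N * (2 * N) = 17 * √N := by
      nth_rewrite 3 [← hNN]
      field_simp
      ring
    have h := clog_mul_noise_le hT hN'.le (show 0 ≤ 17 * √N by positivity) hε
    rw [hK, e1, e2, mul_one]
    have e3 : √N * (17 * √N) * Real.log T ^ 2 / ε = 17 * (N * Real.log T ^ 2 / ε) := by
      rw [mul_left_comm, hNN]
      ring
    rw [e3] at h
    linarith [Real.sqrt_nonneg (T : ℝ)]

/-! ### The cube. -/

theorem isCompact_cube (N : ℕ) : IsCompact (cube N) := by
  have h : cube N = EuclideanSpace.equiv (Fin N) ℝ ⁻¹' Set.univ.pi fun _ => Set.Icc (-1) 1 := by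
    ext x
    simp only [cube, Set.mem_preimage, Set.mem_univ_pi, Set.mem_Icc, ← abs_le]
    rfl
  rw [h]
  exact (EuclideanSpace.equiv (Fin N) ℝ).toHomeomorph.isCompact_preimage.2
    (isCompact_univ_pi fun _ => isCompact_Icc)

theorem convex_cube (N : ℕ) : Convex ℝ (cube N) := by
  intro x hx y hy a b ha hb hab i
  rw [PiLp.add_apply, PiLp.smul_apply, PiLp.smul_apply, smul_eq_mul, smul_eq_mul]
  refine (abs_add_le _ _).trans ?_
  rw [abs_mul, abs_mul, abs_of_nonneg ha, abs_of_nonneg hb]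
  nlinarith [hx i, hy i]

theorem norm_sq_le_of_mem_cube {N : ℕ} {x : Vec N} (hx : x ∈ cube N) : ‖x‖ ^ 2 ≤ N := by
  rw [EuclideanSpace.norm_sq_eq]
  calc _ ≤ ∑ _i : Fin N, (1 : ℝ) :=
        Finset.sum_le_sum fun i _ => pow_le_one₀ (norm_nonneg _) (hx i)
    _ = N := by simp

theorem norm_le_one_of_mem_ball1 {N : ℕ} {x : Vec N} (hx : x ∈ ball1 N) : ‖x‖ ≤ 1 := by
  rw [← sq_le_one_iff₀ (norm_nonneg x), EuclideanSpace.norm_sq_eq]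
  have h : ∑ i, |x i| ≤ 1 := hx
  refine le_trans (Finset.sum_le_sum fun i _ => ?_) h
  have h1 : |x i| ≤ 1 :=
    (Finset.single_le_sum (f := fun i => |x i|) (fun _ _ => abs_nonneg _)
      (Finset.mem_univ i)).trans h
  rw [Real.norm_eq_abs]
  nlinarith [abs_nonneg (x i)]

theorem regretLE_cube {N T : ℕ} (hN : 1 ≤ N) (hT : 1 ≤ T) {ε : ℝ} (hε : 0 < ε)
    {l : ℕ → Vec N} (hl : ∀ t ∈ Finset.Icc 1 T, l t ∈ ball1 N) :
    RegretLE (cube N) sqReg √(N / T) (Real.logb 2 T / ε) T l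
      (48 * (√(N * T) + N * Real.log T ^ 2 / ε)) := by
  have hN' : (0 : ℝ) < N := by exact_mod_cast hN
  obtain ⟨hη, e1, e2⟩ := step_size_balance hN' hT
  rw [← one_mul (Real.logb 2 T)]
  refine regretLE_sqReg (isCompact_cube N) ⟨0, fun i => by simp⟩ (convex_cube N) hη
    (fun x => norm_sq_le_of_mem_cube) hT (fun t ht => norm_le_one_of_mem_ball1 (hl t ht))
    (W := fun z => 2 * ∑ i, |z i|) (fun x hx y hy z => ?_)
    (integral_laplaceVec_le (noise_scale_nonneg hT zero_le_one hε) (by fun_prop)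
      (fun z => by positivity) (fun c hc z => ?_) (a := 0) (b := 4) (fun z => ?_)) ?_
  · rw [PiLp.inner_apply, Finset.mul_sum]
    refine Finset.sum_le_sum fun i _ => ?_
    calc ⟪(x - y) i, z i⟫ = (x i - y i) * z i := by simp [mul_comm]
      _ ≤ |x i - y i| * |z i| := by rw [← abs_mul]; exact le_abs_self _
      _ ≤ 2 * |z i| := by
        gcongr
        linarith [abs_sub (x i) (y i), hx i, hy i]
  · simp only [PiLp.smul_apply, smul_eq_mul, abs_mul, abs_of_nonneg hc, ← Finset.mul_sum]
    ring
  · linarith [sum_abs_le_expSum z]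
  · have h := clog_mul_noise_le hT zero_le_one (show 0 ≤ 0 + 4 * (2 * (N : ℝ)) by positivity) hε
    rw [e1, e2, mul_comm (N : ℝ) T]
    have e3 : 1 * (0 + 4 * (2 * (N : ℝ))) * Real.log T ^ 2 / ε
        = 8 * (N * Real.log T ^ 2 / ε) := by ring
    rw [e3] at h
    linarith [Real.sqrt_nonneg ((T : ℝ) * N)]

/-! ### The simplex. -/

theorem simplex_one_subsingleton : (simplex 1).Subsingleton := by
  intro x hx y hy
  have h1 := hx.2
  have h2 := hy.2
  rw [Fin.sum_univ_one] at h1 h2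
  ext i
  rw [Subsingleton.elim i 0, h1, h2]

theorem regretLE_simplex_one {T : ℕ} (hT : 1 ≤ T) {η lam : ℝ} (hη : 0 < η) {l : ℕ → Vec 1} :
    RegretLE (simplex 1) entropicReg η lam T l 0 := by
  have hs := simplex_one_subsingleton
  have hp : ∀ L, leader (simplex 1) entropicReg η L ∈ simplex 1 := fun L => by
    rw [leader_entropicReg le_rfl]
    exact expWeights_mem_simplex le_rfl η L
  refine regretLE_of_stable (isBounded_simplex 1) hη (fun L => ⟨hp L, ?_⟩) ?_ (D := 0) (S := 0)
    (fun x hx y hy => by rw [hs hx hy, sub_self]) hT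
    (fun t _ L => by rw [hs (hp L) (hp (L + l t)), sub_self, inner_zero_right])
    (w := 0) (W := fun _ => 0) (fun x hx y hy z => by rw [hs hx hy, sub_self, inner_zero_left])
    (integrable_const _) (by simp) (by simp)
  · rw [leader_entropicReg le_rfl]
    exact isMinOn_expWeights le_rfl η L
  · rw [leader_entropicReg le_rfl]
    exact continuous_expWeights le_rfl η

theorem regretLE_simplex {N T : ℕ} (hN : 2 ≤ N) (hT : 1 ≤ T) {ε : ℝ} (hε : 0 < ε)
    {l : ℕ → Vec N} (hl : ∀ t ∈ Finset.Icc 1 T, l t ∈ cube N) :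
    RegretLE (simplex N) entropicReg √(Real.log N / T) (N * Real.logb 2 T / ε) T l
      (48 * (√(T * Real.log N) + N * Real.log T ^ 2 * Real.log N / ε)) := by
  have hN1 : 1 ≤ N := by omega
  have hN' : (0 : ℝ) < N := by positivity
  have hlogN : 0 < Real.log N := Real.log_pos (by exact_mod_cast hN)
  have hlog : Real.log (2 * N) ≤ 2 * Real.log N := by
    rw [Real.log_mul two_ne_zero hN'.ne', two_mul]
    have : Real.log 2 ≤ Real.log N := Real.log_le_log two_pos (by exact_mod_cast hN)
    linarith
  obtain ⟨hη, e1, e2⟩ := step_size_balance hlogN hT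
  obtain ⟨hi, hw⟩ := integral_laplaceVec_le (N := N) (noise_scale_nonneg hT hN'.le hε)
    (W := fun z => 2 * ‖WithLp.ofLp z‖) (by fun_prop) (fun z => by positivity)
    (fun c hc z => by rw [WithLp.ofLp_smul, norm_smul, Real.norm_of_nonneg hc]; ring)
    (a := 4 * Real.log (2 * N) - 4) (b := 2 / N) (fun z => by
      refine (mul_le_mul_of_nonneg_left (supNorm_le_expSum hN1 z) two_pos.le).trans (le_of_eq ?_)
      ring)
  -- The constant `-4` from the tangent line cancels the mean of the `expSum` term, leaving a pure
  -- multiple of `log N`, as the bound demands.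
  have hK : 4 * Real.log (2 * N) - 4 + 2 / N * (2 * N) ≤ 8 * Real.log N := by
    have : (2 : ℝ) / N * (2 * N) = 4 := by field_simp; norm_num
    linarith
  refine regretLE_of_stable (isBounded_simplex N) hη (fun L => ?_) ?_ (D := Real.log N)
    (S := 4 * √(Real.log N / T))
    (fun x hx y hy => by linarith [entropicReg_nonpos hx, neg_log_le_entropicReg hN1 hy]) hT
    (fun t ht L => ?_) (fun x hx y hy z => inner_sub_le_of_mem_simplex hx hy z) hi
    (hw.trans (mul_le_mul_of_nonneg_left hK (noise_scale_nonneg hT hN'.le hε))) ?_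
  · rw [leader_entropicReg hN1]
    exact ⟨expWeights_mem_simplex hN1 _ L, isMinOn_expWeights hN1 _ L⟩
  · rw [leader_entropicReg hN1]
    exact continuous_expWeights hN1 _
  · rw [leader_entropicReg hN1]
    exact expWeights_stable hN1 hη (hl t ht) L
  · have h := clog_mul_noise_le hT hN'.le (show 0 ≤ 8 * Real.log N by positivity) hε
    rw [mul_left_comm (T : ℝ), e1, e2]
    have e3 : N * (8 * Real.log N) * Real.log T ^ 2 / ε
        = 8 * (N * Real.log T ^ 2 * Real.log N / ε) := by ring
    rw [e3] at h
    linarith [Real.sqrt_nonneg (T * Real.log N)]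

end PrivateFTRL

theorem corollary3p2 :
    -- prediction with expert advice
    (∃ C : ℝ, 0 < C ∧ ∀ N T : ℕ, 1 ≤ N → 1 ≤ T → ∃ η : ℝ, 0 < η ∧
      ∀ ε : ℝ, 0 < ε → ∀ l : ℕ → PrivateFTRL.Vec N,
        (∀ t ∈ Finset.Icc 1 T, l t ∈ PrivateFTRL.cube N) →
        PrivateFTRL.RegretLE (PrivateFTRL.simplex N) PrivateFTRL.entropicReg η
          (N * Real.logb 2 T / ε) T l
          (C * (√(T * Real.log N) + N * Real.log T ^ 2 * Real.log N / ε))) ∧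
    -- online linear optimization over the sphere
    (∃ C : ℝ, 0 < C ∧ ∀ N T : ℕ, 1 ≤ N → 1 ≤ T → ∃ η : ℝ, 0 < η ∧
      ∀ ε : ℝ, 0 < ε → ∀ l : ℕ → PrivateFTRL.Vec N,
        (∀ t ∈ Finset.Icc 1 T, l t ∈ PrivateFTRL.ball2 N) →
        PrivateFTRL.RegretLE (PrivateFTRL.ball2 N) PrivateFTRL.sqReg η
          (√N * Real.logb 2 T / ε) T l
          (C * (√T + N * Real.log T ^ 2 / ε))) ∧
    -- online linear optimization over the cube
    (∃ C : ℝ, 0 < C ∧ ∀ N T : ℕ, 1 ≤ N → 1 ≤ T → ∃ η : ℝ, 0 < η ∧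
      ∀ ε : ℝ, 0 < ε → ∀ l : ℕ → PrivateFTRL.Vec N,
        (∀ t ∈ Finset.Icc 1 T, l t ∈ PrivateFTRL.ball1 N) →
        PrivateFTRL.RegretLE (PrivateFTRL.cube N) PrivateFTRL.sqReg η
          (Real.logb 2 T / ε) T l
          (C * (√(N * T) + N * Real.log T ^ 2 / ε))) := by
  refine ⟨⟨48, by norm_num, fun N T hN hT => ?_⟩,
    ⟨102, by norm_num, fun N T hN hT => ⟨√(1 / T), ?_, fun ε hε l hl =>
      PrivateFTRL.regretLE_ball2 hN hT hε hl⟩⟩,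
    ⟨48, by norm_num, fun N T hN hT => ⟨√(N / T), ?_, fun ε hε l hl =>
      PrivateFTRL.regretLE_cube hN hT hε hl⟩⟩⟩
  · rcases hN.eq_or_lt with rfl | hN
    -- For `N = 1` the step size `√(log N / T)` would be `0`. The simplex is a single point, so the
    -- regret bound `0` holds with any positive step size.
    · refine ⟨1, one_pos, fun ε _ l _ => ?_⟩
      simpa using PrivateFTRL.regretLE_simplex_one hT one_pos
    · refine ⟨√(Real.log N / T), ?_, fun ε hε l hl => PrivateFTRL.regretLE_simplex hN hT hε hl⟩
      exact (PrivateFTRL.step_size_balance (Real.log_pos (by exact_mod_cast hN)) hT).1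
  · exact (PrivateFTRL.step_size_balance one_pos hT).1
  · exact (PrivateFTRL.step_size_balance (by exact_mod_cast hN) hT).1
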